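/- Let $\mathbb E_0$ be the relation of eventual equality on $2^\omega$: $\eta\mathrel{\mathbb E_0}\nu$ iff there is $n$ with $\eta(m)=\nu(m)$ for all $m>n$. A topological space is *strong Choquet* if player B has a winning strategy in the following game: in round $n$ player A plays an open set $U_n\subseteq V_{n-1}$ (where $V_{-1}=X$) and a point $x_n\in U_n$, player B answers with an open set $V_n$ such that $x_n\in V_n\subseteq U_n$, and B wins iff $\bigcap_n V_n\neq\emptyset$. For a group $\Gamma$ of homeomorphisms of $X$, $\Delta\subseteq\Gamma$ and $A\subseteq X$ write $\Delta\cdot A=\bigcup_{\gamma\in\Delta}\gamma\cdot A$, and $\Gamma\cdot x=\Gamma\cdot\{x\}$. **Theorem.** Let $X$ be a regular strong Choquet space (not necessarily Hausdorff), $\Gamma$ a group of homeomorphisms of $X$, and $Y\subseteq X$ a $\Gamma$-invariant set. Let $\mathcal U$ be the family of open sets $U\subseteq X$ for which there is no finite $\Delta\subseteq\Gamma$ with $Y\subseteq\Delta\cdot U$, and let $\mathcal I_{\mathcal U}$ be the ideal of all $F\subseteq X$ such that for every $U\in\mathcal U$ there is an open $V\supseteq F$ with $V\cup U\in\mathcal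 U$. Let $(R_n)_{n\in\mathbb N}$ be an increasing sequence of reflexive symmetric closed subsets of $X\times X$, and write $R_n^{(4)}=R_n\circ R_n\circ R_n\circ R_n$. Suppose that $K\subseteq X$ is compact, $K\notin\mathcal I_{\mathcal U}$, and (a) for all $n\in\mathbb N$ and $x\in K$ there is $\gamma\in\Gamma$ with $(x,\gamma\cdot x)\notin R_n^{(4)}$; (b) for all $\gamma\in\Gamma$ there is $n\in\mathbb N$ such that $(x,\gamma\cdot x)\in R_n$ for all $x\in\Gamma\cdot K$. Then there is a map $\varphi:2^\omega\to\mathcal P(X)$ such that for all $y,z\in2^\omega$: 1. $\varphi(y)$ is a nonempty closed $G_\delta$ subset of $X$; 2. if $z\mathrel{\mathbb E_0}y$, then $\gamma\cdot\varphi(z)=\varphi(y)$ for some $\gamma\in\Gamma$; 3. if $z$ and $y$ are not $\mathbb E_0$-equivalent, then $\varphi(y)\times\varphi(z)$ is disjoint from $\bigcup_n R_n$. In particular, there is a map $f:2^\omega\to X$ with $f(y)\in\varphi(y)$ for all $y$, which sends $\mathbb E_0$-equivalent points to points of the same $\Gamma$-orbit and $\mathbb E_0$-inequivalent points to pairs outside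 $\bigcup_n R_n$. Moreover, if $X$ is compact, then there is $x\in K$ such that the map $\psi(y)=\varphi(y)\cap\overline{\Gamma\cdot x}$ takes nonempty closed values (which are $G_\delta$ relative to $\overline{\Gamma\cdot x}$) and satisfies 2 and 3 in place of $\varphi$, and there is a map $f:2^\omega\to\overline{\Gamma\cdot x}$ which sends $\mathbb E_0$-equivalent points to points of the same $\Gamma$-orbit and $\mathbb E_0$-inequivalent points to pairs outside $\bigcup_n R_n$. -/

import Mathlib

open scoped SetRel

/-- The relation `𝔼₀` of eventual equality on the Cantor space `2^ω`. -/
def EZero (η ν : ℕ → Bool) : Prop :=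
  ∃ n, ∀ m, n < m → η m = ν m

section Games

variable {X : Type*} [TopologicalSpace X]

/-- A strategy for player B in the strong Choquet game: it answers a finite list of moves
`(U₀, x₀), …, (Uₙ, xₙ)` of player A (an open set together with a point) by an open set. -/
abbrev ChoquetStrategy (X : Type*) [TopologicalSpace X] : Type _ :=
  List (TopologicalSpace.Opens X × X) → TopologicalSpace.Opens X

/-- The open set `Vₙ` that player B plays in round `n` when following the strategy `σ` while
player A's moves are `a 0, a 1, …`. -/
def ChoquetStrategy.response (σ : ChoquetStrategy X) (a : ℕ → TopologicalSpace.Opens X × X)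
    (n : ℕ) : TopologicalSpace.Opens X :=
  σ ((List.range (n + 1)).map a)

/-- Player A's move `(Uₙ, xₙ)` in round `n` obeys the rules of the strong Choquet game:
`xₙ ∈ Uₙ` and `Uₙ ⊆ Vₙ₋₁`, where `V₋₁ = X`. -/
def ChoquetStrategy.LegalA (σ : ChoquetStrategy X) (a : ℕ → TopologicalSpace.Opens X × X)
    (n : ℕ) : Prop :=
  (a n).2 ∈ (a n).1 ∧ ∀ m, m + 1 = n → (a n).1 ≤ σ.response a m

/-- Player B's answer `Vₙ` in round `n` obeys the rules of the strong Choquet game: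
`xₙ ∈ Vₙ ⊆ Uₙ`. -/
def ChoquetStrategy.LegalB (σ : ChoquetStrategy X) (a : ℕ → TopologicalSpace.Opens X × X)
    (n : ℕ) : Prop :=
  (a n).2 ∈ σ.response a n ∧ σ.response a n ≤ (a n).1

/-- `σ` is a winning strategy for player B: as long as player A obeys the rules, so does B,
and if A obeys the rules in all rounds, then `⋂ₙ Vₙ` is nonempty. -/
def ChoquetStrategy.IsWinning (σ : ChoquetStrategy X) : Prop :=
  ∀ a : ℕ → TopologicalSpace.Opens X × X,
    (∀ n, (∀ k ≤ n, σ.LegalA a k) → σ.LegalB a n) ∧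
    ((∀ n, σ.LegalA a n) → (⋂ n, (σ.response a n : Set X)).Nonempty)

/-- `X` is a strong Choquet space: player B has a winning strategy in the strong Choquet game. -/
def IsStrongChoquet (X : Type*) [TopologicalSpace X] : Prop :=
  ∃ σ : ChoquetStrategy X, σ.IsWinning

end Games

section Translates

variable {X : Type*} [TopologicalSpace X]

/-- `Δ · A`, the union of the translates `γ · A` for `γ ∈ Δ`. -/
def translates (Δ : Set (X ≃ₜ X)) (A : Set X) : Set X :=
  ⋃ γ ∈ Δ, γ '' A

/-- The family of open sets `U` such that no finitely many `Γ`-translates of `U` cover `Y`. -/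
def nonCovering (Γ : Subgroup (X ≃ₜ X)) (Y : Set X) : Set (Set X) :=
  {U | IsOpen U ∧
    ¬ ∃ Δ : Set (X ≃ₜ X), Δ.Finite ∧ Δ ⊆ (Γ : Set (X ≃ₜ X)) ∧ Y ⊆ translates Δ U}

/-- The ideal associated with a family `𝒰` of open sets: `F` belongs to it iff every `U ∈ 𝒰` has
an open `V ⊇ F` with `V ∪ U ∈ 𝒰`. -/
def associatedIdeal (𝒰 : Set (Set X)) : Set (Set X) :=
  {F | ∀ U ∈ 𝒰, ∃ V, IsOpen V ∧ F ⊆ V ∧ V ∪ U ∈ 𝒰}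

end Translates

open Set Filter Topology TopologicalSpace

/-!
Let `x` be a support point of `K`: no neighbourhood of `x` meets `K` in a set of the ideal. Take a
compact `F ⊆ K` near `x` outside the ideal and a closed neighbourhood `D` of `F`. If every point of
`F` could be moved off any finitely many translates of `D`, then by compactness local covers would
patch together to a cover of `Y` by finitely many translates of some `U ∈ 𝒰`. So the orbit of some
point of `F` stays in finitely many translates of `D`, and by (a) and (b) this point is brought back
into `D` by some `γ ∈ Γ` which moves it `R n`-far away. Hence `x` can be replaced by a nearby
support point `z` for which `γ z` is near `x` as well, but `R n`-far from `z`.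

Iterating this splitting, with player B's answers keeping all the intersections nonempty, gives a
Cantor scheme of translates of a single decreasing sequence of open sets. Branches that agree from
some point on differ by a fixed element of `Γ`, and branches that differ infinitely often are
separated from every `R n`.
-/

section Ideal

variable {X : Type*} [TopologicalSpace X] {𝒰 : Set (Set X)} {F G K : Set X}

theorem mem_associatedIdeal_of_subset (hFG : F ⊆ G) (hG : G ∈ associatedIdeal 𝒰) :
    F ∈ associatedIdeal 𝒰 := fun U hU =>
  let ⟨V, hV, hGV, hVU⟩ := hG U hU
  ⟨V, hV, hFG.trans hGV, hVU⟩

theorem empty_mem_associatedIdeal (𝒰 : Set (Set X)) : ∅ ∈ associatedIdeal 𝒰 := fun U hU =>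
  ⟨∅, isOpen_empty, Subset.rfl, by rwa [empty_union]⟩

theorem union_mem_associatedIdeal (hF : F ∈ associatedIdeal 𝒰) (hG : G ∈ associatedIdeal 𝒰) :
    F ∪ G ∈ associatedIdeal 𝒰 := fun U hU => by
  obtain ⟨V, hV, hFV, hVU⟩ := hF U hU
  obtain ⟨W, hW, hGW, hWVU⟩ := hG _ hVU
  refine ⟨V ∪ W, hV.union hW, union_subset_union hFV hGW, ?_⟩
  rwa [union_comm V, union_assoc]

theorem exists_isOpen_sdiff_notMem_associatedIdeal (hF : F ∉ associatedIdeal 𝒰)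
    (hG : G ∈ associatedIdeal 𝒰) :
    ∃ V, IsOpen V ∧ G ⊆ V ∧ F \ V ∉ associatedIdeal 𝒰 := by
  by_contra! hsmall
  refine hF fun U hU => ?_
  obtain ⟨V, hV, hGV, hVU⟩ := hG U hU
  obtain ⟨W, hW, hFW, hWVU⟩ := hsmall V hV hGV _ hVU
  exact ⟨W ∪ V, hW.union hV, sdiff_subset_iff.1 hFW |>.trans (union_comm V W).subset,
    by rwa [union_assoc]⟩

/-- The support of `K` modulo the ideal associated with `𝒰`: `x` is a support point if the ideal
contains no trace on `K` of a neighbourhood of `x`. The centres of the scheme are such points. -/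
def IsSupportPoint (𝒰 : Set (Set X)) (K : Set X) (x : X) : Prop :=
  ∀ W ∈ 𝓝 x, K ∩ W ∉ associatedIdeal 𝒰

theorem IsSupportPoint.mono {x : X} (hFK : F ⊆ K) (hx : IsSupportPoint 𝒰 F x) :
    IsSupportPoint 𝒰 K x := fun W hW hKW =>
  hx W hW (mem_associatedIdeal_of_subset (inter_subset_inter_left W hFK) hKW)

theorem exists_isSupportPoint (hK : IsCompact K) (hpos : K ∉ associatedIdeal 𝒰) :
    ∃ x ∈ K, IsSupportPoint 𝒰 K x := by
  by_contra! hnone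
  refine hpos (inter_self K ▸ hK.induction_on (p := fun s => K ∩ s ∈ associatedIdeal 𝒰)
    ?_ ?_ ?_ fun x hx => ?_)
  · exact (inter_empty K).symm ▸ empty_mem_associatedIdeal 𝒰
  · exact fun s t hst => mem_associatedIdeal_of_subset (inter_subset_inter_right K hst)
  · exact fun s t hs ht => inter_union_distrib_left K s t ▸ union_mem_associatedIdeal hs ht
  · obtain ⟨W, hW, hKW⟩ : ∃ W ∈ 𝓝 x, K ∩ W ∈ associatedIdeal 𝒰 := by
      simpa only [IsSupportPoint, not_forall, not_not, exists_prop] using hnone x hx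
    exact ⟨W, mem_nhdsWithin_of_mem_nhds hW, hKW⟩

theorem exists_isSupportPoint_of_sdiff_mem {O : Set X} (hF : IsCompact F)
    (hpos : F ∉ associatedIdeal 𝒰) (hO : F \ O ∈ associatedIdeal 𝒰) :
    ∃ x ∈ F ∩ O, IsSupportPoint 𝒰 F x := by
  obtain ⟨V, hV, hOV, hVpos⟩ := exists_isOpen_sdiff_notMem_associatedIdeal hpos hO
  obtain ⟨x, hx, hxs⟩ := exists_isSupportPoint (hF.diff hV) hVpos
  exact ⟨x, ⟨hx.1, not_not.1 fun hxO => hx.2 (hOV ⟨hx.1, hxO⟩)⟩, hxs.mono sdiff_subset⟩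

end Ideal

section Covers

variable {X : Type*} [TopologicalSpace X] {Γ : Subgroup (X ≃ₜ X)} {A A₁ A₂ B C Y : Set X}

theorem mem_translates {Δ : Set (X ≃ₜ X)} {z : X} :
    z ∈ translates Δ A ↔ ∃ γ ∈ Δ, ∃ a ∈ A, γ a = z := by
  simp only [translates, mem_iUnion, mem_image, exists_prop]

theorem translates_union (Δ : Set (X ≃ₜ X)) (A B : Set X) :
    translates Δ (A ∪ B) = translates Δ A ∪ translates Δ B := by
  simp only [translates, image_union, iUnion_union_distrib]

theorem isClosed_translates {Δ : Set (X ≃ₜ X)} (hΔ : Δ.Finite) (hA : IsClosed A) :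
    IsClosed (translates Δ A) :=
  hΔ.isClosed_biUnion fun γ _ => γ.isClosedMap _ hA

theorem subset_translates (Γ : Subgroup (X ≃ₜ X)) (A : Set X) :
    A ⊆ translates (Γ : Set (X ≃ₜ X)) A := fun a ha =>
  mem_translates.2 ⟨1, Γ.one_mem, a, ha, rfl⟩

theorem apply_mem_translates {γ : X ≃ₜ X} (hγ : γ ∈ Γ) {x : X}
    (hx : x ∈ translates (Γ : Set (X ≃ₜ X)) A) : γ x ∈ translates (Γ : Set (X ≃ₜ X)) A := by
  obtain ⟨δ, hδ, a, ha, rfl⟩ := mem_translates.1 hx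
  exact mem_translates.2 ⟨γ * δ, Γ.mul_mem hγ hδ, a, ha, rfl⟩

theorem image_closure_translates {γ : X ≃ₜ X} (hγ : γ ∈ Γ) :
    γ '' closure (translates (Γ : Set (X ≃ₜ X)) A) =
      closure (translates (Γ : Set (X ≃ₜ X)) A) := by
  have himage : γ '' translates (Γ : Set (X ≃ₜ X)) A = translates (Γ : Set (X ≃ₜ X)) A := by
    refine Subset.antisymm ?_ fun z hz => ?_
    · rintro _ ⟨x, hx, rfl⟩
      exact apply_mem_translates hγ hx
    · exact ⟨γ⁻¹ z, apply_mem_translates (Γ.inv_mem hγ) hz, γ.apply_symm_apply z⟩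
  rw [γ.image_closure, himage]

/-- `A` is covered by finitely many `Γ`-translates of `B`. An open set `U` thus lies in
`nonCovering Γ Y` iff `Y` is not covered in this sense by `U`. -/
def IsCoveredByTranslates (Γ : Subgroup (X ≃ₜ X)) (A B : Set X) : Prop :=
  ∃ Δ : Set (X ≃ₜ X), Δ.Finite ∧ Δ ⊆ (Γ : Set (X ≃ₜ X)) ∧ A ⊆ translates Δ B

namespace IsCoveredByTranslates

theorem of_subset_image {γ : X ≃ₜ X} (hγ : γ ∈ Γ) (h : A ⊆ γ '' B) :
    IsCoveredByTranslates Γ A B :=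
  ⟨{γ}, finite_singleton γ, singleton_subset_iff.2 hγ, by rwa [translates, biUnion_singleton]⟩

theorem of_subset (h : A ⊆ B) : IsCoveredByTranslates Γ A B :=
  of_subset_image Γ.one_mem (h.trans (image_id B).superset)

theorem union (h₁ : IsCoveredByTranslates Γ A₁ B) (h₂ : IsCoveredByTranslates Γ A₂ B) :
    IsCoveredByTranslates Γ (A₁ ∪ A₂) B := by
  obtain ⟨Δ₁, hfin₁, hΓ₁, hA₁⟩ := h₁
  obtain ⟨Δ₂, hfin₂, hΓ₂, hA₂⟩ := h₂
  refine ⟨Δ₁ ∪ Δ₂, hfin₁.union hfin₂, union_subset hΓ₁ hΓ₂, ?_⟩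
  rw [translates, biUnion_union]
  exact union_subset_union hA₁ hA₂

theorem trans (hAB : IsCoveredByTranslates Γ A B) (hBC : IsCoveredByTranslates Γ B C) :
    IsCoveredByTranslates Γ A C := by
  obtain ⟨Δ₁, hfin₁, hΓ₁, hA⟩ := hAB
  obtain ⟨Δ₂, hfin₂, hΓ₂, hB⟩ := hBC
  refine ⟨image2 (· * ·) Δ₁ Δ₂, hfin₁.image2 _ hfin₂,
    image2_subset_iff.2 fun δ₁ h₁ δ₂ h₂ => Γ.mul_mem (hΓ₁ h₁) (hΓ₂ h₂), fun a ha => ?_⟩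
  obtain ⟨δ₁, hδ₁, b, hb, rfl⟩ := mem_translates.1 (hA ha)
  obtain ⟨δ₂, hδ₂, c, hc, rfl⟩ := mem_translates.1 (hB hb)
  exact mem_translates.2 ⟨δ₁ * δ₂, mem_image2_of_mem hδ₁ hδ₂, c, hc, rfl⟩

theorem inter_union_of_invariant (hY : ∀ γ ∈ Γ, γ '' Y = Y)
    (h : IsCoveredByTranslates Γ Y (A ∪ B)) : IsCoveredByTranslates Γ Y (A ∩ Y ∪ B) := by
  obtain ⟨Δ, hfin, hΓ, hYΔ⟩ := h
  refine ⟨Δ, hfin, hΓ, fun y hy => ?_⟩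
  obtain ⟨δ, hδ, w, hw, rfl⟩ := mem_translates.1 (hYΔ hy)
  have hwY : w ∈ Y := δ.injective.mem_set_image.1 ((hY δ (hΓ hδ)).symm ▸ hy)
  exact mem_translates.2 ⟨δ, hδ, w, hw.imp_left fun hwA => ⟨hwA, hwY⟩, rfl⟩

end IsCoveredByTranslates

theorem exists_forall_isCoveredByTranslates_union {F : Set X}
    (hF : F ∉ associatedIdeal (nonCovering Γ Y)) :
    ∃ U ∈ nonCovering Γ Y, ∀ V, IsOpen V → F ⊆ V → IsCoveredByTranslates Γ Y (V ∪ U) := by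
  simp only [associatedIdeal, mem_ofPred_eq, not_forall, not_exists, not_and] at hF
  obtain ⟨U, hU, hFU⟩ := hF
  exact ⟨U, hU, fun V hV hFV => not_not.1 fun hcov => hFU V hV hFV ⟨hV.union hU.1, hcov⟩⟩

theorem exists_isOpen_superset_isCoveredByTranslates_inter {F U : Set X} (hF : IsCompact F)
    (hloc : ∀ x ∈ F, ∃ V, IsOpen V ∧ x ∈ V ∧ IsCoveredByTranslates Γ (V ∩ Y) U) :
    ∃ V, IsOpen V ∧ F ⊆ V ∧ IsCoveredByTranslates Γ (V ∩ Y) U := by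
  refine hF.induction_on
    (p := fun s => ∃ V, IsOpen V ∧ s ⊆ V ∧ IsCoveredByTranslates Γ (V ∩ Y) U) ?_ ?_ ?_ ?_
  · exact ⟨∅, isOpen_empty, Subset.rfl, .of_subset (by simp only [empty_inter, empty_subset])⟩
  · rintro s t hst ⟨V, hV, htV, hcov⟩
    exact ⟨V, hV, hst.trans htV, hcov⟩
  · rintro s t ⟨V, hV, hsV, hVU⟩ ⟨W, hW, htW, hWU⟩
    exact ⟨V ∪ W, hV.union hW, union_subset_union hsV htW,
      union_inter_distrib_right V W Y ▸ hVU.union hWU⟩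
  · intro x hx
    obtain ⟨V, hV, hxV, hcov⟩ := hloc x hx
    exact ⟨V, mem_nhdsWithin_of_mem_nhds (hV.mem_nhds hxV), V, hV, Subset.rfl, hcov⟩

/-- Otherwise every point of `F` could be moved off the given finitely many translates of `D`, hence
into the translates of `U` which complete them to a cover of `Y`. -/
theorem exists_orbit_subset_translates (hY : ∀ γ ∈ Γ, γ '' Y = Y) {F D : Set X}
    (hF : IsCompact F) (hpos : F ∉ associatedIdeal (nonCovering Γ Y)) (hD : IsClosed D)
    (hFD : F ⊆ interior D) :
    ∃ x ∈ F, ∃ Δ : Set (X ≃ₜ X), Δ.Finite ∧ Δ ⊆ (Γ : Set (X ≃ₜ X)) ∧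
      ∀ γ ∈ Γ, γ x ∈ translates Δ D := by
  obtain ⟨U, hU, hcov⟩ := exists_forall_isCoveredByTranslates_union hpos
  obtain ⟨Δ, hΔ, hΔΓ, hYΔ⟩ := hcov _ isOpen_interior hFD
  by_contra! hescape
  have hYdiff : Y \ translates Δ D ⊆ translates Δ U := by
    have hDU : Y ⊆ translates Δ (D ∪ U) := hYΔ.trans <|
      biUnion_mono Subset.rfl fun δ _ => image_mono (union_subset_union_left U interior_subset)
    rwa [sdiff_subset_iff, ← translates_union]
  obtain ⟨V, hV, hFV, hVU⟩ : ∃ V, IsOpen V ∧ F ⊆ V ∧ IsCoveredByTranslates Γ (V ∩ Y) U := by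
    refine exists_isOpen_superset_isCoveredByTranslates_inter hF fun x hx => ?_
    obtain ⟨γ, hγ, hγx⟩ := hescape x hx Δ hΔ hΔΓ
    refine ⟨γ ⁻¹' (translates Δ D)ᶜ,
      (isClosed_translates hΔ hD).isOpen_compl.preimage γ.continuous, hγx, ?_⟩
    refine .trans (.of_subset_image (Γ.inv_mem hγ) fun y hy => ?_) ⟨Δ, hΔ, hΔΓ, hYdiff⟩
    exact ⟨γ y, ⟨hY γ hγ ▸ mem_image_of_mem γ hy.2, hy.1⟩, γ.symm_apply_apply y⟩
  exact hU.2 <| ((hcov V hV hFV).inter_union_of_invariant hY).trans <|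
    hVU.union (.of_subset Subset.rfl)

end Covers

theorem notMem_of_notMem_comp {α : Type*} {Q : SetRel α α} (hQ : Q.IsSymm) {x y x' y' : α}
    (hx : (x, x') ∈ Q) (hy : (y, y') ∈ Q) (hfar : (x, y) ∉ Q ○ Q ○ Q) : (x', y') ∉ Q := fun h =>
  hfar ⟨y', ⟨x', hx, h⟩, hQ.symm _ _ hy⟩

section Splitting

variable {X : Type*} [TopologicalSpace X] {Γ : Subgroup (X ≃ₜ X)} {Y K : Set X}
  {R : ℕ → SetRel X X}

theorem eventually_displacement_mem (hRmono : Monotone R)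
    (hb : ∀ γ ∈ Γ, ∃ n, ∀ x ∈ translates (Γ : Set (X ≃ₜ X)) K, (x, γ x) ∈ R n)
    {Δ : Set (X ≃ₜ X)} (hΔ : Δ.Finite) (hΔΓ : Δ ⊆ Γ) :
    ∀ᶠ n in atTop, ∀ δ ∈ Δ, ∀ x ∈ translates (Γ : Set (X ≃ₜ X)) K, (x, δ x) ∈ R n := by
  refine (eventually_all_finite hΔ).2 fun δ hδ => ?_
  obtain ⟨n, hn⟩ := hb δ (hΔΓ hδ)
  exact (eventually_ge_atTop n).mono fun k hnk x hx => hRmono hnk (hn x hx)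

theorem exists_far_return (hY : ∀ γ ∈ Γ, γ '' Y = Y) (hRmono : Monotone R)
    (ha : ∀ n, ∀ x ∈ K, ∃ γ ∈ Γ, (x, γ x) ∉ R n ○ R n ○ R n ○ R n)
    (hb : ∀ γ ∈ Γ, ∃ n, ∀ x ∈ translates (Γ : Set (X ≃ₜ X)) K, (x, γ x) ∈ R n)
    {F D : Set X} (hF : IsCompact F) (hFK : F ⊆ K)
    (hpos : F ∉ associatedIdeal (nonCovering Γ Y)) (hD : IsClosed D) (hFD : F ⊆ interior D)
    (m : ℕ) :
    ∃ x ∈ F, ∃ γ ∈ Γ, γ x ∈ D ∧ (x, γ x) ∉ R m ○ R m ○ R m := by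
  obtain ⟨x, hx, Δ, hΔ, hΔΓ, horbit⟩ := exists_orbit_subset_translates hY hF hpos hD hFD
  obtain ⟨k, hk, hmk⟩ :=
    ((eventually_displacement_mem hRmono hb hΔ hΔΓ).and (eventually_ge_atTop m)).exists
  obtain ⟨γ, hγ, hfar⟩ := ha k x (hFK hx)
  obtain ⟨δ, hδ, d, hd, hδd⟩ := mem_translates.1 (horbit γ hγ)
  obtain rfl : (δ⁻¹ * γ) x = d := by
    rw [Homeomorph.mul_apply, ← hδd]
    exact δ.symm_apply_apply d
  have hδγ : δ⁻¹ * γ ∈ Γ := Γ.mul_mem (Γ.inv_mem (hΔΓ hδ)) hγ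
  refine ⟨x, hx, δ⁻¹ * γ, hδγ, hd, fun ⟨c, ⟨b, hxb, hbc⟩, hcd⟩ => hfar ?_⟩
  refine ⟨(δ⁻¹ * γ) x, ⟨c, ⟨b, hRmono hmk hxb, hRmono hmk hbc⟩, hRmono hmk hcd⟩, ?_⟩
  exact hδd ▸ hk δ hδ _ (apply_mem_translates hδγ (subset_translates Γ K (hFK hx)))

theorem eventually_forall_apply_notMem {Q : SetRel X X} (hQ : IsClosed Q) {S : Set (X ≃ₜ X)}
    (hS : S.Finite) {z w : X} (h : ∀ s ∈ S, ∀ t ∈ S, (s z, t w) ∉ Q) :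
    ∀ᶠ p : X × X in 𝓝 (z, w), ∀ s ∈ S, ∀ t ∈ S, (s p.1, t p.2) ∉ Q := by
  refine (eventually_all_finite hS).2 fun s hs => (eventually_all_finite hS).2 fun t ht => ?_
  have hcont : Continuous fun p : X × X => (s p.1, t p.2) := by fun_prop
  exact (hcont.tendsto (z, w)).eventually (hQ.isOpen_compl.mem_nhds (h s hs t ht))

theorem IsSupportPoint.exists_far_isSupportPoint [RegularSpace X] (hY : ∀ γ ∈ Γ, γ '' Y = Y)
    (hRmono : Monotone R) (hRsymm : ∀ n, (R n).IsSymm) (hRclosed : ∀ n, IsClosed (R n))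
    (hK : IsCompact K) (ha : ∀ n, ∀ x ∈ K, ∃ γ ∈ Γ, (x, γ x) ∉ R n ○ R n ○ R n ○ R n)
    (hb : ∀ γ ∈ Γ, ∃ n, ∀ x ∈ translates (Γ : Set (X ≃ₜ X)) K, (x, γ x) ∈ R n)
    {x : X} (hx : IsSupportPoint (nonCovering Γ Y) K x) {W : Set X} (hW : W ∈ 𝓝 x)
    {S : Set (X ≃ₜ X)} (hS : S.Finite) (hSΓ : S ⊆ Γ) (n : ℕ) :
    ∃ γ ∈ Γ, ∃ z ∈ K, IsSupportPoint (nonCovering Γ Y) K z ∧ W ∈ 𝓝 z ∧ W ∈ 𝓝 (γ z) ∧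
      ∀ s ∈ S, ∀ t ∈ S, (s z, t (γ z)) ∉ R n := by
  obtain ⟨D, hDx, hD, hDW⟩ := exists_mem_nhds_isClosed_subset (interior_mem_nhds.2 hW)
  obtain ⟨C, hCx, hC, hCD⟩ := exists_mem_nhds_isClosed_subset (interior_mem_nhds.2 hDx)
  obtain ⟨m, hm, hnm⟩ :=
    ((eventually_displacement_mem hRmono hb hS hSΓ).and (eventually_ge_atTop n)).exists
  let O : Set X := {z | ∃ γ ∈ Γ, γ z ∈ interior W ∧ ∀ s ∈ S, ∀ t ∈ S, (s z, t (γ z)) ∉ R n}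
  have hO : IsOpen O := isOpen_iff_eventually.2 fun z ⟨γ, hγ, hγz, hsep⟩ => by
    have hdiag : Tendsto (fun u => (u, γ u)) (𝓝 z) (𝓝 (z, γ z)) :=
      (continuous_id.prodMk γ.continuous).tendsto z
    filter_upwards [(isOpen_interior.preimage γ.continuous).mem_nhds hγz,
      hdiag.eventually (eventually_forall_apply_notMem (hRclosed n) hS hsep)] with u hu husep
    exact ⟨γ, hγ, hu, husep⟩
  have hKC : IsCompact (K ∩ C) := hK.inter_right hC
  have hsmall : (K ∩ C) \ O ∈ associatedIdeal (nonCovering Γ Y) := by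
    by_contra hpos
    obtain ⟨z, ⟨⟨hzK, -⟩, hzO⟩, γ, hγ, hγzD, hfar⟩ := exists_far_return hY hRmono ha hb
      (hKC.diff hO) (sdiff_subset.trans inter_subset_left) hpos hD
      (sdiff_subset.trans (inter_subset_right.trans hCD)) m
    have hzΓ : z ∈ translates (Γ : Set (X ≃ₜ X)) K := subset_translates Γ K hzK
    refine hzO ⟨γ, hγ, hDW hγzD, fun s hs t ht hst => ?_⟩
    exact notMem_of_notMem_comp (hRsymm m) (hm s hs z hzΓ)
      (hm t ht _ (apply_mem_translates hγ hzΓ)) hfar (hRmono hnm hst)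
  obtain ⟨z, ⟨⟨hzK, hzC⟩, γ, hγ, hγz, hsep⟩, hz⟩ :=
    exists_isSupportPoint_of_sdiff_mem hKC (hx C hCx) hsmall
  exact ⟨γ, hγ, z, hzK, hz.mono inter_subset_left,
    mem_interior_iff_mem_nhds.1 (hDW (interior_subset (hCD hzC))),
    mem_interior_iff_mem_nhds.1 hγz, hsep⟩

theorem exists_opens_closure_subset_of_eventually [RegularSpace X] {x : X} {N : Set X}
    (hN : N ∈ 𝓝 x) {p : X × X → Prop} (hp : ∀ᶠ q in 𝓝 (x, x), p q) :
    ∃ O : Opens X, x ∈ O ∧ closure (O : Set X) ⊆ N ∧ ∀ u ∈ O, ∀ v ∈ O, p (u, v) := by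
  rw [nhds_prod_eq, eventually_prod_self_iff'] at hp
  obtain ⟨T, hT, hTp⟩ := hp
  obtain ⟨O, ⟨hxO, hO⟩, hOT⟩ := (hasBasis_opens_closure x).mem_iff.1 (inter_mem hN hT)
  exact ⟨⟨O, hO⟩, hxO, hOT.trans inter_subset_left,
    fun u hu v hv => hTp u (hOT (subset_closure hu)).2 v (hOT (subset_closure hv)).2⟩

theorem IsSupportPoint.exists_splitting [RegularSpace X] (hY : ∀ γ ∈ Γ, γ '' Y = Y)
    (hRmono : Monotone R) (hRsymm : ∀ n, (R n).IsSymm) (hRclosed : ∀ n, IsClosed (R n))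
    (hK : IsCompact K) (ha : ∀ n, ∀ x ∈ K, ∃ γ ∈ Γ, (x, γ x) ∉ R n ○ R n ○ R n ○ R n)
    (hb : ∀ γ ∈ Γ, ∃ n, ∀ x ∈ translates (Γ : Set (X ≃ₜ X)) K, (x, γ x) ∈ R n)
    {x : X} (hx : IsSupportPoint (nonCovering Γ Y) K x) {W : Set X} (hW : W ∈ 𝓝 x)
    {S : Set (X ≃ₜ X)} (hS : S.Finite) (hSΓ : S ⊆ Γ) (n : ℕ) :
    ∃ h : Bool → X ≃ₜ X, (∀ b, h b ∈ Γ) ∧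
      ∃ z ∈ K, IsSupportPoint (nonCovering Γ Y) K z ∧
        ∃ O : Opens X, z ∈ O ∧ closure (O : Set X) ⊆ W ∧ (∀ b, MapsTo (h b) (closure O) W) ∧
          ∀ b c, b ≠ c → ∀ u ∈ O, ∀ v ∈ O, ∀ s ∈ S, ∀ t ∈ S,
            (s (h b u), t (h c v)) ∉ R n := by
  obtain ⟨γ, hγ, z, hzK, hz, hWz, hWγz, hsep⟩ :=
    hx.exists_far_isSupportPoint hY hRmono hRsymm hRclosed hK ha hb hW hS hSΓ n
  have hγ_cont : Continuous fun p : X × X => (p.1, γ p.2) := by fun_prop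
  obtain ⟨O, hzO, hOW, hOsep⟩ := exists_opens_closure_subset_of_eventually
    (inter_mem hWz (γ.continuous.continuousAt hWγz))
    ((hγ_cont.tendsto (z, z)).eventually
      (eventually_forall_apply_notMem (hRclosed n) hS hsep))
  refine ⟨fun b => bif b then γ else 1, Bool.forall_bool.2 ⟨Γ.one_mem, hγ⟩, z, hzK, hz, O, hzO,
    hOW.trans inter_subset_left,
    Bool.forall_bool.2 ⟨fun u hu => (hOW hu).1, fun u hu => (hOW hu).2⟩, ?_⟩
  rintro (_ | _) (_ | _) hbc u hu v hv s hs t ht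
  · exact absurd rfl hbc
  · exact hOsep u hu v hv s hs t ht
  · exact fun hR => hOsep v hv u hu t ht s hs ((hRsymm n).symm _ _ hR)
  · exact absurd rfl hbc

end Splitting

namespace ChoquetStrategy

variable {X : Type*} [TopologicalSpace X] {σ : ChoquetStrategy X} {p : List (Opens X × X)}
  {m m' : Opens X × X}

theorem response_congr (σ : ChoquetStrategy X) {a b : ℕ → Opens X × X} {n : ℕ}
    (h : ∀ k ≤ n, a k = b k) : σ.response a n = σ.response b n :=
  congrArg σ <| List.map_congr_left fun k hk => h k (Nat.lt_succ_iff.1 (List.mem_range.1 hk))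

/-- `p` lists player A's moves in a nonempty finite legal play against `σ`, and `m` is the last of
them; player B is about to answer with `σ p`. -/
def IsPlay (σ : ChoquetStrategy X) (p : List (Opens X × X)) (m : Opens X × X) : Prop :=
  ∃ (a : ℕ → Opens X × X) (n : ℕ),
    p = (List.range (n + 1)).map a ∧ m = a n ∧ ∀ k ≤ n, σ.LegalA a k

theorem IsPlay.mem (h : σ.IsPlay p m) : m.2 ∈ m.1 := by
  obtain ⟨a, n, rfl, rfl, ha⟩ := h
  exact (ha n le_rfl).1

theorem IsPlay.mem_answer (hσ : σ.IsWinning) (h : σ.IsPlay p m) : m.2 ∈ σ p := by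
  obtain ⟨a, n, rfl, rfl, ha⟩ := h
  exact ((hσ a).1 n ha).1

theorem IsPlay.answer_le (hσ : σ.IsWinning) (h : σ.IsPlay p m) : σ p ≤ m.1 := by
  obtain ⟨a, n, rfl, rfl, ha⟩ := h
  exact ((hσ a).1 n ha).2

theorem isPlay_singleton (hm : m.2 ∈ m.1) : σ.IsPlay [m] m :=
  ⟨fun _ => m, 0, rfl, rfl, fun _ hk => ⟨hm, fun _ hj => by omega⟩⟩

theorem IsPlay.append (h : σ.IsPlay p m) (hm' : m'.2 ∈ m'.1) (hle : m'.1 ≤ σ p) :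
    σ.IsPlay (p ++ [m']) m' := by
  obtain ⟨a, n, rfl, rfl, ha⟩ := h
  let a' := Function.update a (n + 1) m'
  have hlast : a' (n + 1) = m' := Function.update_self _ _ _
  have hagree : ∀ k ≤ n, a' k = a k := fun k hk => Function.update_of_ne (by omega) _ _
  have hresponse : ∀ k ≤ n, σ.response a' k = σ.response a k := fun k hk =>
    σ.response_congr fun j hj => hagree j (hj.trans hk)
  refine ⟨a', n + 1, ?_, hlast.symm, fun k hk => ?_⟩
  · rw [List.range_succ (n := n + 1), List.map_append, List.map_singleton, hlast]
    congr 1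
    exact List.map_congr_left fun k hk =>
      (hagree k (Nat.lt_succ_iff.1 (List.mem_range.1 hk))).symm
  · obtain hk | rfl := Nat.le_succ_iff.1 hk
    · refine ⟨hagree k hk ▸ (ha k hk).1, fun j hj => ?_⟩
      rw [hagree k hk, hresponse j (by omega)]
      exact (ha k hk).2 j hj
    · refine ⟨hlast.symm ▸ hm', fun j hj => ?_⟩
      obtain rfl : j = n := by omega
      rw [hlast, hresponse j le_rfl]
      exact hle

theorem IsWinning.nonempty_iInter {p : ℕ → List (Opens X × X)} {m : ℕ → Opens X × X}
    (hσ : σ.IsWinning) (hp_zero : p 0 = [m 0]) (hp_succ : ∀ n, p (n + 1) = p n ++ [m (n + 1)])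
    (hm : ∀ n, (m n).2 ∈ (m n).1) (hle : ∀ n, (m (n + 1)).1 ≤ σ (p n)) :
    (⋂ n, (σ (p n) : Set X)).Nonempty := by
  obtain rfl : p = fun n => (List.range (n + 1)).map m := by
    funext n
    induction n with
    | zero => exact hp_zero
    | succ n ih => rw [hp_succ, ih, List.range_succ (n := n + 1), List.map_append,
        List.map_singleton]
  exact (hσ m).2 fun n => ⟨hm n, fun k hk => hk ▸ hle k⟩

end ChoquetStrategy

section EventualEquality

theorem eZero_iff_eventuallyEq {y z : ℕ → Bool} : EZero y z ↔ y =ᶠ[atTop] z := by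
  simp only [EZero, EventuallyEq, atTop_basis_Ioi.eventually_iff, true_and, mem_Ioi]

theorem exists_equivariant_selection {α X : Type*} [TopologicalSpace X] {Γ : Subgroup (X ≃ₜ X)}
    (r : Setoid α) {φ : α → Set X} (hne : ∀ a, (φ a).Nonempty)
    (hφ : ∀ a b, r b a → ∃ γ ∈ Γ, γ '' φ b = φ a) :
    ∃ f : α → X, (∀ a, f a ∈ φ a) ∧ ∀ a b, r b a → ∃ γ ∈ Γ, γ (f b) = f a := by
  choose p hp using hne
  let rep : α → α := fun a => (Quotient.mk r a).out
  choose g hgΓ hg using fun a => hφ a (rep a) (Quotient.mk_out a)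
  refine ⟨fun a => g a (p (rep a)), fun a => hg a ▸ mem_image_of_mem _ (hp _), fun a b hba => ?_⟩
  have hrep : rep b = rep a := congrArg Quotient.out (Quotient.sound hba)
  refine ⟨g a * (g b)⁻¹, Γ.mul_mem (hgΓ a) (Γ.inv_mem (hgΓ b)), ?_⟩
  rw [← Homeomorph.mul_apply, inv_mul_cancel_right, hrep]

end EventualEquality

/-- A Cantor scheme all of whose sets at level `n` are `Γ`-translates of one open set `base n`. The
sets are indexed by branches: the one around the branch `y` is `translate n y '' base n`. -/
structure OrbitScheme {X : Type*} [TopologicalSpace X] (Γ : Subgroup (X ≃ₜ X))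
    (R : ℕ → SetRel X X) (K : Set X) where
  base : ℕ → Opens X
  translate : ℕ → (ℕ → Bool) → X ≃ₜ X
  inter_base_nonempty : ∀ n, (K ∩ base n).Nonempty
  translate_mem : ∀ n y, translate n y ∈ Γ
  closure_base_succ : ∀ n, closure (base (n + 1) : Set X) ⊆ base n
  image_closure_base_succ : ∀ n y,
    translate (n + 1) y '' closure (base (n + 1)) ⊆ translate n y '' base n
  translate_succ_mul_inv : ∀ n y z, y n = z n →
    translate (n + 1) y * (translate (n + 1) z)⁻¹ = translate n y * (translate n z)⁻¹
  separated : ∀ n y z, y n ≠ z n → ∀ u ∈ base (n + 1), ∀ v ∈ base (n + 1),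
    (translate (n + 1) y u, translate (n + 1) z v) ∉ R n
  iInter_nonempty : ∀ y, (⋂ n, translate n y '' (base n : Set X)).Nonempty

namespace OrbitScheme

variable {X : Type*} [TopologicalSpace X] {Γ : Subgroup (X ≃ₜ X)} {R : ℕ → SetRel X X} {K : Set X}
  (S : OrbitScheme Γ R K)

/-- The set which the scheme associates with a branch `y`. -/
def branchSet (y : ℕ → Bool) : Set X :=
  ⋂ n, S.translate n y '' (S.base n : Set X)

theorem branchSet_eq_iInter_closure (y : ℕ → Bool) :
    S.branchSet y = ⋂ n, S.translate n y '' closure (S.base n) :=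
  (iInter_mono fun _ => image_mono subset_closure).antisymm <| subset_iInter fun n =>
    (iInter_subset _ (n + 1)).trans (S.image_closure_base_succ n y)

theorem antitone_image_base (y : ℕ → Bool) :
    Antitone fun n => S.translate n y '' (S.base n : Set X) :=
  antitone_nat_of_succ_le fun n =>
    (image_mono subset_closure).trans (S.image_closure_base_succ n y)

theorem isClosed_branchSet (y : ℕ → Bool) : IsClosed (S.branchSet y) := by
  rw [branchSet_eq_iInter_closure]
  exact isClosed_iInter fun n => (S.translate n y).isClosedMap _ isClosed_closure

theorem isGδ_branchSet (y : ℕ → Bool) : IsGδ (S.branchSet y) :=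
  .iInter_of_isOpen fun n => (S.translate n y).isOpenMap _ (S.base n).isOpen

theorem translate_mul_inv_eq {y z : ℕ → Bool} {N n : ℕ} (hyz : ∀ m, N ≤ m → y m = z m)
    (hn : N ≤ n) :
    S.translate n y * (S.translate n z)⁻¹ = S.translate N y * (S.translate N z)⁻¹ := by
  induction n, hn using Nat.le_induction with
  | base => rfl
  | succ n hn ih => rw [S.translate_succ_mul_inv n y z (hyz n hn), ih]

theorem exists_image_branchSet_eq {y z : ℕ → Bool} (hzy : EZero z y) :
    ∃ γ ∈ Γ, γ '' S.branchSet z = S.branchSet y := by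
  obtain ⟨N, hN⟩ := eventually_atTop.1 (eZero_iff_eventuallyEq.1 hzy)
  let γ := S.translate N y * (S.translate N z)⁻¹
  have htail : ∀ y, S.branchSet y = ⋂ n, S.translate (n + N) y '' (S.base (n + N) : Set X) :=
    fun y => ((S.antitone_image_base y).iInter_nat_add N).symm
  have hγ : ∀ n, γ * S.translate (n + N) z = S.translate (n + N) y := fun n =>
    eq_mul_inv_iff_mul_eq.1
      (S.translate_mul_inv_eq (fun m hm => (hN m hm).symm) (Nat.le_add_left N n)).symm
  refine ⟨γ, Γ.mul_mem (S.translate_mem N y) (Γ.inv_mem (S.translate_mem N z)), ?_⟩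
  rw [htail, htail, image_iInter γ.bijective]
  exact iInter_congr fun n => by rw [← hγ, ← image_comp]; rfl

theorem branchSet_prod_subset (hRmono : Monotone R) {y z : ℕ → Bool} (hzy : ¬ EZero z y) :
    S.branchSet y ×ˢ S.branchSet z ⊆ (⋃ n, R n)ᶜ := by
  rintro ⟨p, q⟩ ⟨hp, hq⟩ hpq
  obtain ⟨n, hn⟩ := mem_iUnion.1 hpq
  obtain ⟨m, hnm, hm⟩ : ∃ m > n, z m ≠ y m := by
    simp only [EZero, not_exists, not_forall, exists_prop] at hzy
    exact hzy n
  obtain ⟨u, hu, rfl⟩ := mem_iInter.1 hp (m + 1)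
  obtain ⟨v, hv, rfl⟩ := mem_iInter.1 hq (m + 1)
  exact S.separated m y z hm.symm u hu v hv (hRmono hnm.le hn)

theorem exists_mem_forall_mem_closure_base (hK : IsCompact K) :
    ∃ x ∈ K, ∀ n, x ∈ closure (S.base n : Set X) := by
  choose x hxK hx using S.inter_base_nonempty
  have hanti : Antitone S.base :=
    antitone_nat_of_succ_le fun n => subset_closure.trans (S.closure_base_succ n)
  obtain ⟨w, hwK, hw⟩ := hK.exists_mapClusterPt (f := atTop) (u := x)
    (tendsto_principal.2 (Eventually.of_forall hxK))
  refine ⟨w, hwK, fun n => isClosed_closure.mem_of_mapClusterPt hw ?_⟩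
  exact (eventually_ge_atTop n).mono fun k hk => subset_closure (hanti hk (hx k))

theorem branchSet_inter_closure_orbit_nonempty [CompactSpace X] {x : X}
    (hx : ∀ n, x ∈ closure (S.base n : Set X)) (y : ℕ → Bool) :
    (S.branchSet y ∩ closure (translates (Γ : Set (X ≃ₜ X)) {x})).Nonempty := by
  have hclosed : ∀ n, IsClosed (S.translate n y '' closure (S.base n : Set X) ∩
      closure (translates (Γ : Set (X ≃ₜ X)) {x})) := fun n =>
    ((S.translate n y).isClosedMap _ isClosed_closure).inter isClosed_closure
  rw [branchSet_eq_iInter_closure, iInter_inter]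
  refine IsCompact.nonempty_iInter_of_sequence_nonempty_isCompact_isClosed _ (fun n => ?_)
    (fun n => ?_) (hclosed 0).isCompact hclosed
  · exact inter_subset_inter_left _
      ((S.image_closure_base_succ n y).trans (image_mono subset_closure))
  · exact ⟨S.translate n y x, mem_image_of_mem _ (hx n), subset_closure
      (apply_mem_translates (S.translate_mem n y) (subset_translates Γ {x} rfl))⟩

theorem exists_image_branchSet_inter_closure_eq (A : Set X) {y z : ℕ → Bool} (hzy : EZero z y) :
    ∃ γ ∈ Γ, γ '' (S.branchSet z ∩ closure (translates (Γ : Set (X ≃ₜ X)) A)) =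
      S.branchSet y ∩ closure (translates (Γ : Set (X ≃ₜ X)) A) := by
  obtain ⟨γ, hγ, himage⟩ := S.exists_image_branchSet_eq hzy
  exact ⟨γ, hγ, by rw [image_inter γ.injective, himage, image_closure_translates hγ]⟩

theorem exists_separating_selection (hRmono : Monotone R) {ψ : (ℕ → Bool) → Set X}
    (hne : ∀ y, (ψ y).Nonempty) (hsub : ∀ y, ψ y ⊆ S.branchSet y)
    (hψ : ∀ y z, EZero z y → ∃ γ ∈ Γ, γ '' ψ z = ψ y) :
    ∃ f : (ℕ → Bool) → X, (∀ y, f y ∈ ψ y) ∧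
      (∀ y z, EZero z y → ∃ γ ∈ Γ, γ (f z) = f y) ∧
      ∀ y z, ¬ EZero z y → (f y, f z) ∉ ⋃ n, R n := by
  obtain ⟨f, hfψ, hf⟩ := exists_equivariant_selection (germSetoid atTop Bool) hne
    fun y z hzy => hψ y z (eZero_iff_eventuallyEq.2 hzy)
  exact ⟨f, hfψ, fun y z hzy => hf y z (eZero_iff_eventuallyEq.1 hzy), fun y z hzy =>
    S.branchSet_prod_subset hRmono hzy ⟨hsub y (hfψ y), hsub z (hfψ z)⟩⟩

end OrbitScheme

/-- The image under `g` of a move of player A. -/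
def translateMove {X : Type*} [TopologicalSpace X] (g : X ≃ₜ X) (m : Opens X × X) :
    Opens X × X :=
  (⟨g '' m.1, g.isOpenMap _ m.1.isOpen⟩, g m.2)

/-- A stage in the construction of an `OrbitScheme`: one level of the scheme, together with the
legal plays against `σ` in which the translates of `(base, point)` along the branches are the latest
moves of player A. Finiteness of the range says that only finitely many branches are distinguished
so far. -/
structure SchemeStage {X : Type*} [TopologicalSpace X] (σ : ChoquetStrategy X)
    (Γ : Subgroup (X ≃ₜ X)) (𝒰 : Set (Set X)) (K : Set X) where
  base : Opens X
  point : X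
  translate : (ℕ → Bool) → X ≃ₜ X
  play : (ℕ → Bool) → List (Opens X × X)
  finite_range : (range fun y => (translate y, play y)).Finite
  point_mem : point ∈ K
  isSupportPoint : IsSupportPoint 𝒰 K point
  translate_mem : ∀ y, translate y ∈ Γ
  isPlay : ∀ y, σ.IsPlay (play y) (translateMove (translate y) (base, point))

namespace SchemeStage

variable {X : Type*} [TopologicalSpace X] {σ : ChoquetStrategy X} {Γ : Subgroup (X ≃ₜ X)}
  {𝒰 : Set (Set X)} {R : ℕ → SetRel X X} {K : Set X}

/-- The latest move of player A along the branch `y`. -/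
def move (s : SchemeStage σ Γ 𝒰 K) (y : ℕ → Bool) : Opens X × X :=
  translateMove (s.translate y) (s.base, s.point)

/-- The stage `t` continues the stage `s` by splitting the branches according to their coordinate
`n`, keeping apart with respect to `R n` those which differ there. -/
structure IsNext (R : ℕ → SetRel X X) (n : ℕ) (s t : SchemeStage σ Γ 𝒰 K) : Prop where
  play_eq : ∀ y, t.play y = s.play y ++ [t.move y]
  closure_base : closure (t.base : Set X) ⊆ s.base
  image_closure_base : ∀ y, t.translate y '' closure t.base ⊆ σ (s.play y)
  translate_mul_inv : ∀ y z, y n = z n →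
    t.translate y * (t.translate z)⁻¹ = s.translate y * (s.translate z)⁻¹
  separated : ∀ y z, y n ≠ z n → ∀ u ∈ t.base, ∀ v ∈ t.base,
    (t.translate y u, t.translate z v) ∉ R n

theorem point_mem_base (s : SchemeStage σ Γ 𝒰 K) : s.point ∈ s.base := by
  let y : ℕ → Bool := fun _ => false
  exact (s.translate y).injective.mem_set_image.1 (s.isPlay y).mem

theorem finite_range_translate (s : SchemeStage σ Γ 𝒰 K) : (range s.translate).Finite :=
  (s.finite_range.image Prod.fst).subset <|
    range_subset_iff.2 fun y => mem_image_of_mem Prod.fst (mem_range_self y)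

theorem eventually_apply_mem_answer (hσ : σ.IsWinning) (s : SchemeStage σ Γ 𝒰 K) :
    ∀ᶠ u in 𝓝 s.point, ∀ y, s.translate y u ∈ σ (s.play y) := by
  have hall : ∀ᶠ u in 𝓝 s.point, ∀ q ∈ range fun y => (s.translate y, s.play y),
      q.1 u ∈ σ q.2 := by
    refine (eventually_all_finite s.finite_range).2 (forall_mem_range.2 fun y => ?_)
    exact (s.translate y).continuous.continuousAt
      ((σ (s.play y)).isOpen.mem_nhds ((s.isPlay y).mem_answer hσ))
  exact hall.mono fun u hu => forall_mem_range.1 hu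

theorem mem_base_of_forall_apply_mem_answer (hσ : σ.IsWinning) (s : SchemeStage σ Γ 𝒰 K) {u : X}
    (hu : ∀ y, s.translate y u ∈ σ (s.play y)) : u ∈ s.base := by
  let y : ℕ → Bool := fun _ => false
  exact (s.translate y).injective.mem_set_image.1 ((s.isPlay y).answer_le hσ (hu y))

/-- The splitting of a stage into two copies, by the homeomorphisms `h b`, along coordinate `n`. -/
def split (s : SchemeStage σ Γ 𝒰 K) (n : ℕ) (h : Bool → X ≃ₜ X) (hΓ : ∀ b, h b ∈ Γ)
    {z : X} (hzK : z ∈ K) (hz : IsSupportPoint 𝒰 K z) {O : Opens X} (hzO : z ∈ O)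
    (hO : ∀ y, MapsTo (s.translate y * h (y n)) O (σ (s.play y))) : SchemeStage σ Γ 𝒰 K where
  base := O
  point := z
  translate y := s.translate y * h (y n)
  play y := s.play y ++ [translateMove (s.translate y * h (y n)) (O, z)]
  finite_range := by
    let next : ((X ≃ₜ X) × List (Opens X × X)) × Bool → (X ≃ₜ X) × List (Opens X × X) :=
      fun q => (q.1.1 * h q.2, q.1.2 ++ [translateMove (q.1.1 * h q.2) (O, z)])
    refine ((s.finite_range.prod finite_univ).image next).subset (range_subset_iff.2 fun y => ?_)
    exact ⟨((s.translate y, s.play y), y n), ⟨mem_range_self y, mem_univ _⟩, rfl⟩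
  point_mem := hzK
  isSupportPoint := hz
  translate_mem y := Γ.mul_mem (s.translate_mem y) (hΓ (y n))
  isPlay y := (s.isPlay y).append (mem_image_of_mem _ hzO) (hO y).image_subset

theorem exists_isNext [RegularSpace X] (hσ : σ.IsWinning) {Y : Set X}
    (hY : ∀ γ ∈ Γ, γ '' Y = Y) (hRmono : Monotone R) (hRsymm : ∀ n, (R n).IsSymm)
    (hRclosed : ∀ n, IsClosed (R n)) (hK : IsCompact K)
    (ha : ∀ n, ∀ x ∈ K, ∃ γ ∈ Γ, (x, γ x) ∉ R n ○ R n ○ R n ○ R n)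
    (hb : ∀ γ ∈ Γ, ∃ n, ∀ x ∈ translates (Γ : Set (X ≃ₜ X)) K, (x, γ x) ∈ R n)
    (n : ℕ) (s : SchemeStage σ Γ (nonCovering Γ Y) K) : ∃ t, IsNext R n s t := by
  obtain ⟨h, hΓ, z, hzK, hz, O, hzO, hOW, hhO, hsep⟩ :=
    s.isSupportPoint.exists_splitting hY hRmono hRsymm hRclosed hK ha hb
      (s.eventually_apply_mem_answer hσ) s.finite_range_translate
      (range_subset_iff.2 s.translate_mem) n
  have hclosure : ∀ y, MapsTo (s.translate y * h (y n)) (closure O) (σ (s.play y)) :=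
    fun y u hu => hhO (y n) hu y
  refine ⟨s.split n h hΓ hzK hz hzO fun y => (hclosure y).mono_left subset_closure,
    fun y => rfl, fun u hu => s.mem_base_of_forall_apply_mem_answer hσ (hOW hu),
    fun y => (hclosure y).image_subset, fun y w hyw => ?_, fun y w hyw u hu v hv => ?_⟩
  · simp only [split, hyw, mul_inv_rev, mul_assoc, mul_inv_cancel_left]
  · exact hsep _ _ hyw u hu v hv _ (mem_range_self y) _ (mem_range_self w)

theorem exists_initial (hK : IsCompact K) (hKpos : K ∉ associatedIdeal 𝒰) :
    ∃ s : SchemeStage σ Γ 𝒰 K, ∀ y, s.play y = [s.move y] := by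
  obtain ⟨x, hxK, hx⟩ := exists_isSupportPoint hK hKpos
  refine ⟨{
    base := ⊤
    point := x
    translate := fun _ => 1
    play := fun _ => [translateMove 1 (⊤, x)]
    finite_range := finite_range_const
    point_mem := hxK
    isSupportPoint := hx
    translate_mem := fun _ => Γ.one_mem
    isPlay := fun _ => ChoquetStrategy.isPlay_singleton (mem_image_of_mem _ (mem_univ x)) },
    fun _ => rfl⟩

/-- The levels of the scheme are those of the given sequence of stages. -/
def toOrbitScheme (hσ : σ.IsWinning) (s : ℕ → SchemeStage σ Γ 𝒰 K)
    (hzero : ∀ y, (s 0).play y = [(s 0).move y])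
    (hnext : ∀ n, IsNext R n (s n) (s (n + 1))) : OrbitScheme Γ R K where
  base n := (s n).base
  translate n := (s n).translate
  inter_base_nonempty n := ⟨(s n).point, (s n).point_mem, (s n).point_mem_base⟩
  translate_mem n := (s n).translate_mem
  closure_base_succ n := (hnext n).closure_base
  image_closure_base_succ n y :=
    ((hnext n).image_closure_base y).trans (((s n).isPlay y).answer_le hσ)
  translate_succ_mul_inv n := (hnext n).translate_mul_inv
  separated n := (hnext n).separated
  iInter_nonempty y :=
    (hσ.nonempty_iInter (hzero y) (fun n => (hnext n).play_eq y) (fun n => ((s n).isPlay y).mem)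
      fun n => (image_mono subset_closure).trans ((hnext n).image_closure_base y)).mono
      (iInter_mono fun n => ((s n).isPlay y).answer_le hσ)

end SchemeStage

theorem nonempty_orbitScheme {X : Type*} [TopologicalSpace X] [RegularSpace X]
    (hX : IsStrongChoquet X) {Γ : Subgroup (X ≃ₜ X)} {Y : Set X} (hY : ∀ γ ∈ Γ, γ '' Y = Y)
    {R : ℕ → SetRel X X} (hRmono : Monotone R) (hRsymm : ∀ n, (R n).IsSymm)
    (hRclosed : ∀ n, IsClosed (R n)) {K : Set X} (hK : IsCompact K)
    (hKpos : K ∉ associatedIdeal (nonCovering Γ Y))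
    (ha : ∀ n, ∀ x ∈ K, ∃ γ ∈ Γ, (x, γ x) ∉ R n ○ R n ○ R n ○ R n)
    (hb : ∀ γ ∈ Γ, ∃ n, ∀ x ∈ translates (Γ : Set (X ≃ₜ X)) K, (x, γ x) ∈ R n) :
    Nonempty (OrbitScheme Γ R K) := by
  obtain ⟨σ, hσ⟩ := hX
  obtain ⟨initial, hinitial⟩ := SchemeStage.exists_initial (σ := σ) (Γ := Γ) hK hKpos
  choose next hnext using
    SchemeStage.exists_isNext (σ := σ) hσ hY hRmono hRsymm hRclosed hK ha hb
  let stage : ℕ → SchemeStage σ Γ (nonCovering Γ Y) K := fun n => Nat.rec initial next n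
  exact ⟨SchemeStage.toOrbitScheme hσ stage hinitial fun n => hnext n (stage n)⟩

theorem theorem2p8 {X : Type*} [TopologicalSpace X] [RegularSpace X]
    (hX : IsStrongChoquet X)
    (Γ : Subgroup (X ≃ₜ X))
    (Y : Set X) (hY : ∀ γ ∈ Γ, γ '' Y = Y)
    (R : ℕ → SetRel X X) (hRmono : Monotone R)
    (hRrefl : ∀ n, (R n).IsRefl) (hRsymm : ∀ n, (R n).IsSymm)
    (hRclosed : ∀ n, IsClosed (R n))
    (K : Set X) (hKcompact : IsCompact K)
    (hKpos : K ∉ associatedIdeal (nonCovering Γ Y))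
    (ha : ∀ n, ∀ x ∈ K, ∃ γ ∈ Γ, (x, γ x) ∉ R n ○ R n ○ R n ○ R n)
    (hb : ∀ γ ∈ Γ, ∃ n, ∀ x ∈ translates (Γ : Set (X ≃ₜ X)) K, (x, γ x) ∈ R n) :
    -- the set-valued map
    ∃ φ : (ℕ → Bool) → Set X,
      (∀ y, (φ y).Nonempty ∧ IsClosed (φ y) ∧ IsGδ (φ y)) ∧
      (∀ y z, EZero z y → ∃ γ ∈ Γ, γ '' φ z = φ y) ∧
      (∀ y z, ¬ EZero z y → φ y ×ˢ φ z ⊆ (⋃ n, R n)ᶜ) ∧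
      -- the resulting homomorphism into `X`
      (∃ f : (ℕ → Bool) → X,
        (∀ y, f y ∈ φ y) ∧
        (∀ y z, EZero z y → ∃ γ ∈ Γ, γ (f z) = f y) ∧
        (∀ y z, ¬ EZero z y → (f y, f z) ∉ ⋃ n, R n)) ∧
      -- the compact case: both maps can be taken inside the closure of `Γ · x`
      (CompactSpace X → ∃ x ∈ K,
        (∃ ψ : (ℕ → Bool) → Set X,
          (∀ y, (ψ y).Nonempty ∧ IsClosed (ψ y) ∧
            ψ y = φ y ∩ closure (translates (Γ : Set (X ≃ₜ X)) {x})) ∧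
          (∀ y z, EZero z y → ∃ γ ∈ Γ, γ '' ψ z = ψ y) ∧
          (∀ y z, ¬ EZero z y → ψ y ×ˢ ψ z ⊆ (⋃ n, R n)ᶜ)) ∧
        (∃ f : (ℕ → Bool) → X,
          (∀ y, f y ∈ closure (translates (Γ : Set (X ≃ₜ X)) {x})) ∧
          (∀ y z, EZero z y → ∃ γ ∈ Γ, γ (f z) = f y) ∧
          (∀ y z, ¬ EZero z y → (f y, f z) ∉ ⋃ n, R n))) := by
  obtain ⟨S⟩ :=
    nonempty_orbitScheme hX hY hRmono hRsymm hRclosed hKcompact hKpos ha hb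
  have hequiv : ∀ y z, EZero z y → ∃ γ ∈ Γ, γ '' S.branchSet z = S.branchSet y :=
    fun _ _ => S.exists_image_branchSet_eq
  refine ⟨S.branchSet,
    fun y => ⟨S.iInter_nonempty y, S.isClosed_branchSet y, S.isGδ_branchSet y⟩, hequiv,
    fun _ _ => S.branchSet_prod_subset hRmono,
    S.exists_separating_selection hRmono S.iInter_nonempty (fun _ => Subset.rfl) hequiv,
    fun _ => ?_⟩
  obtain ⟨x, hxK, hx⟩ := S.exists_mem_forall_mem_closure_base hKcompact
  let ψ : (ℕ → Bool) → Set X := fun y =>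
    S.branchSet y ∩ closure (translates (Γ : Set (X ≃ₜ X)) {x})
  have hψne : ∀ y, (ψ y).Nonempty := S.branchSet_inter_closure_orbit_nonempty hx
  have hψsub : ∀ y, ψ y ⊆ S.branchSet y := fun _ => inter_subset_left
  have hψequiv : ∀ y z, EZero z y → ∃ γ ∈ Γ, γ '' ψ z = ψ y :=
    fun _ _ => S.exists_image_branchSet_inter_closure_eq {x}
  obtain ⟨f, hfψ, hf⟩ := S.exists_separating_selection hRmono hψne hψsub hψequiv
  exact ⟨x, hxK,
    ⟨ψ, fun y => ⟨hψne y, (S.isClosed_branchSet y).inter isClosed_closure, rfl⟩, hψequiv,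
      fun y z hzy =>
        (prod_mono (hψsub y) (hψsub z)).trans (S.branchSet_prod_subset hRmono hzy)⟩,
    f, fun y => (hfψ y).2, hf⟩
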